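/- Let $V$ be an infinite-dimensional vector space over a field $\mathbb{F}$ of characteristic not equal to $2$, and let $\mathfrak{gl}(V)$ be the Lie algebra of all linear transformations $V\to V$ with bracket $[a,b]=ab-ba$. For a cardinal $\alpha$ with $\aleph_0\le\alpha\le\dim_{\mathbb{F}}V$ let $I_\alpha$ be the set of all linear transformations $\varphi:V\to V$ with $\dim_{\mathbb{F}}\varphi(V)<\alpha$, let $\mathrm{Id}_V$ be the identity transformation, and let $[I_{\aleph_0},\mathfrak{gl}(V)]$ be the linear span of all $[\varphi,\psi]$ with $\varphi\in I_{\aleph_0}$ and $\psi\in\mathfrak{gl}(V)$. Then a subspace $U$ of $\mathfrak{gl}(V)$ is an ideal of the Lie algebra $\mathfrak{gl}(V)$ if and only if it belongs to one of the following families: (1) $\{0\}$, $\mathbb{F}\cdot\mathrm{Id}_V$, $\mathfrak{gl}(V)$; (2) $I_\alpha$ or $\mathbb{F}\cdot\mathrm{Id}_V+I_\alpha$, where $\aleph_0\le\alpha\le\dim_{\mathbb{F}}V$; (3) any subspace $U$ with $[I_{\aleph_0},\mathfrak{gl}(V)]\subseteq U\subseteq\mathbb{F}\cdot\mathrm{Id}_V+I_{\aleph_0}$.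 Moreover, $[I_{\aleph_0},\mathfrak{gl}(V)]\subseteq\mathbb{F}\cdot\mathrm{Id}_V+I_{\aleph_0}$, and the codimension of $[I_{\aleph_0},\mathfrak{gl}(V)]$ in $\mathbb{F}\cdot\mathrm{Id}_V+I_{\aleph_0}$ is $2$. -/

import Mathlib

open scoped Cardinal

attribute [local instance 100] LieRing.ofAssociativeRing

/-- For an infinite cardinal `α`, the ideal `I_α` of the Lie algebra `𝔤𝔩(V) = End_F(V)` (with bracket
`⁅f, g⁆ = f * g - g * f`) of all linear maps `φ : V → V` such that `dim φ(V) < α`. -/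
def rankIdeal (F : Type*) {V : Type*} [Field F] [AddCommGroup V] [Module F V]
    (α : Cardinal) (hα : ℵ₀ ≤ α) : LieIdeal F (Module.End F V) where
  carrier := {φ | Module.rank F (LinearMap.range φ) < α}
  add_mem' {f g} hf hg :=
    (LinearMap.rank_add_le f g).trans_lt (Cardinal.add_lt_of_lt hα hf hg)
  zero_mem' := by
    have h : LinearMap.rank (0 : V →ₗ[F] V) < α := by
      rw [LinearMap.rank_zero]
      exact Cardinal.aleph0_pos.trans_le hα
    exact h
  smul_mem' c f hf := by
    refine lt_of_le_of_lt (Submodule.rank_mono ?_) hf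
    rintro _ ⟨v, rfl⟩
    exact ⟨c • v, by simp⟩
  lie_mem {g f} hf := by
    have h1 : LinearMap.rank (g * f) < α := by
      have h := LinearMap.lift_rank_comp_le_right f g
      simp only [Cardinal.lift_id] at h
      exact h.trans_lt hf
    have h2 : LinearMap.rank (-(f * g)) < α := by
      refine lt_of_le_of_lt (Submodule.rank_mono ?_) hf
      rintro _ ⟨v, rfl⟩
      exact ⟨-(g v), by simp⟩
    have h3 : LinearMap.rank (g * f + -(f * g)) < α :=
      (LinearMap.rank_add_le _ _).trans_lt (Cardinal.add_lt_of_lt hα h1 h2)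
    rw [← sub_eq_add_neg] at h3
    exact h3

/-- The subspace `F · Id_V` of scalar transformations. -/
def scalarMaps (F V : Type*) [Field F] [AddCommGroup V] [Module F V] :
    Submodule F (Module.End F V) :=
  Submodule.span F {LinearMap.id}

/-- The subspace `F · Id_V + I_α`. -/
def scalarAddRank (F V : Type*) [Field F] [AddCommGroup V] [Module F V]
    (α : Cardinal) (hα : ℵ₀ ≤ α) : Submodule F (Module.End F V) :=
  scalarMaps F V ⊔ (rankIdeal F α hα).toSubmodule

/-- The subspace `[I_{ℵ₀}, 𝔤𝔩(V)]`, the linear span of all brackets `⁅φ, ψ⁆` with `φ` of finite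
rank and `ψ` arbitrary. -/
def finiteRankCommutators (F V : Type*) [Field F] [AddCommGroup V] [Module F V] :
    Submodule F (Module.End F V) :=
  Submodule.span F {χ | ∃ φ ∈ rankIdeal F (V := V) ℵ₀ le_rfl, ∃ ψ : Module.End F V, ⁅φ, ψ⁆ = χ}

/-!
The argument has two parts: a ring-theoretic one, in the style of Herstein, that traps a Lie ideal
between data attached to a two-sided ideal, and linear algebra that evaluates this data in `End V`.

Let `U` be a Lie ideal of `End V`. The transporter `T = {x | [x, End V] ⊆ U}` contains `U` and is
both a subring and a Lie ideal, and this forces the two-sided ideal generated by `[U, U]` into `T`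
(`commutator_mem_transporterCore`). So the largest two-sided ideal `W` inside `T` satisfies
`[W, End V] ⊆ U` and `[U, U] ⊆ W`. Each `u ∈ U` therefore has `[u, [u, r]] ∈ W` for all `r`; since
the characteristic is not two and `End V` is von Neumann regular, this improves to
`[U, End V] ⊆ W` (`commutator_mem_of_sq_commutator_mem`).

The two-sided ideals of `End V` are `0`, the `I_α` and `End V`, because a map factors through any
map of at least the same rank (`eq_top_or_eq_rankIdeal`).
If `W = 0`, then `U` is central, hence consists of scalars. If `W = I_α`, then `U` is central modulo
`I_α`, and a maximality argument gives `U ⊆ F · Id + I_α` (`exists_rank_sub_smul_lt`). From below, a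
shift operator writes every `φ` as a commutator `[a, s]` with `rank a ≤ ℵ₀ * rank φ`
(`exists_commutator_eq`), so `[W, End V] = W` if `W = End V` or `W = I_α` with `α > ℵ₀`. Only
`W = I_ℵ₀` leaves more freedom, and it gives the third family.

The codimension is two since finite-rank maps have a trace, which vanishes on
`[I_ℵ₀, End V]`, while modulo `[I_ℵ₀, End V]` every rank-one map is its trace times a fixed
idempotent (`rank_quotient_finiteRankCommutators`).
-/

/-! ### Lie ideals of an associative algebra -/

/-- The largest two-sided ideal of `A` inside `{x | ∀ r, [x, r] ∈ U}`, the transporter of `A` into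
`U`. It is recorded as a subspace; closure under multiplication on both sides is
`mul_mem_transporterCore`. -/
def transporterCore {F A : Type*} [Field F] [Ring A] [Algebra F A] (U : Submodule F A) :
    Submodule F A where
  carrier := {w | ∀ p q r : A, p * w * q * r - r * (p * w * q) ∈ U}
  add_mem' {a b} ha hb p q r := by
    have := U.add_mem (ha p q r) (hb p q r)
    convert this using 1
    noncomm_ring
  zero_mem' p q r := by simp
  smul_mem' c a ha p q r := by
    have := U.smul_mem c (ha p q r)
    simpa [smul_sub] using this

section LieIdeals

variable {F A : Type*} [Field F] [Ring A] [Algebra F A]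

theorem mul_mem_transporterCore {U : Submodule F A} {w : A} (hw : w ∈ transporterCore U)
    (p q : A) : p * w * q ∈ transporterCore U := by
  intro p' q' r
  have := hw (p' * p) (q * q') r
  simpa only [mul_assoc] using this

theorem commutator_mem_of_mem_transporterCore {U : Submodule F A} {w : A}
    (hw : w ∈ transporterCore U) (r : A) : w * r - r * w ∈ U := by
  simpa using hw 1 1 r

/-- The transporter `T = {x | ∀ r, [x, r] ∈ U}` of a Lie ideal `U` is a subring and a Lie ideal.
Hence `[a, b] r = [a, b r] - b [a, r]` lies in `T` for `a, b ∈ T`, and commuting with a left factor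
`p` shows that the two-sided ideal generated by `[a, b]` lies in `T` as well. -/
theorem commutator_mem_transporterCore {U : Submodule F A}
    (hU : ∀ u ∈ U, ∀ r : A, u * r - r * u ∈ U) {a b : A} (ha : a ∈ U) (hb : b ∈ U) :
    a * b - b * a ∈ transporterCore U := by
  have hmul : ∀ x y : A, (∀ r, x * r - r * x ∈ U) → (∀ r, y * r - r * y ∈ U) →
      ∀ r, x * y * r - r * (x * y) ∈ U := by
    intro x y hx hy r
    have := U.add_mem (hx (y * r)) (hy (r * x))
    convert this using 1
    noncomm_ring
  -- `(a * b - b * a) * q ∈ T`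
  have hright : ∀ q r : A, (a * b - b * a) * q * r - r * ((a * b - b * a) * q) ∈ U := by
    intro q r
    have h := U.sub_mem (hU _ (hU a ha (b * q)) r)
      (hmul b (a * q - q * a) (hU b hb) (hU _ (hU a ha q)) r)
    convert h using 1
    noncomm_ring
  intro p q r
  have h1 := hU _ (hright q p) r
  have h2 := hright (q * p) r
  have h := U.sub_mem h2 h1
  convert h using 1
  noncomm_ring

/-- In characteristic not two, an element `a` of a von Neumann regular algebra whose inner
derivation squares to zero modulo a two-sided ideal `W` is central modulo `W`: the Leibniz rule
gives `2 [a, r] [a, s] ∈ W`, then `[a, r] t [a, r] ∈ W`, and regularity concludes. -/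
theorem commutator_mem_of_sq_commutator_mem (h2 : (2 : F) ≠ 0)
    (hreg : ∀ x : A, ∃ y, x * y * x = x) {W : Submodule F A}
    (hW : ∀ w ∈ W, ∀ p q : A, p * w * q ∈ W) {a : A}
    (ha : ∀ r : A, a * (a * r - r * a) - (a * r - r * a) * a ∈ W) (r : A) :
    a * r - r * a ∈ W := by
  have hmul : ∀ r s : A, (a * r - r * a) * (a * s - s * a) ∈ W := by
    intro r s
    have h1 := hW _ (ha r) 1 s
    have h3 := hW _ (ha s) r 1
    have h := W.sub_mem (W.sub_mem (ha (r * s)) h1) h3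
    have h' := W.smul_mem (2⁻¹ : F) h
    have e : a * (a * (r * s) - r * s * a) - (a * (r * s) - r * s * a) * a -
        1 * (a * (a * r - r * a) - (a * r - r * a) * a) * s -
        r * (a * (a * s - s * a) - (a * s - s * a) * a) * 1 =
        (2 : F) • ((a * r - r * a) * (a * s - s * a)) := by
      rw [two_smul]
      noncomm_ring
    rwa [e, smul_smul, inv_mul_cancel₀ h2, one_smul] at h'
  obtain ⟨y, hy⟩ := hreg (a * r - r * a)
  rw [← hy]
  have h1 := hmul r (y * r)
  have h3 := hW _ (hmul r y) 1 r
  have h := W.sub_mem h1 h3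
  convert h using 1
  noncomm_ring

end LieIdeals

/-! ### Two-sided ideals of the endomorphism algebra -/

section Ideals

variable {F V : Type*} [Field F] [AddCommGroup V] [Module F V]

theorem exists_eq_mul_mul_of_rank_le {a b : Module.End F V}
    (h : LinearMap.rank b ≤ LinearMap.rank a) : ∃ p q : Module.End F V, b = p * a * q := by
  obtain ⟨j, hj⟩ := rank_le_iff_exists_linearMap.mp h
  obtain ⟨σ, hσ⟩ := a.rangeRestrict.exists_rightInverse_of_surjective a.range_rangeRestrict
  obtain ⟨k, hk⟩ := j.exists_leftInverse_of_injective (LinearMap.ker_eq_bot.mpr hj)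
  obtain ⟨p, hp⟩ := LinearMap.exists_extend (b.range.subtype ∘ₗ k)
  refine ⟨p, σ ∘ₗ j ∘ₗ b.rangeRestrict, LinearMap.ext fun v => ?_⟩
  have h1 : a (σ (j (b.rangeRestrict v))) = j (b.rangeRestrict v) :=
    congrArg Subtype.val (LinearMap.congr_fun hσ (j (b.rangeRestrict v)))
  have h2 := LinearMap.congr_fun hp (j (b.rangeRestrict v))
  have h3 := LinearMap.congr_fun hk (b.rangeRestrict v)
  simp only [LinearMap.comp_apply, Submodule.subtype_apply, LinearMap.id_apply] at h2 h3
  simp only [Module.End.mul_apply, LinearMap.comp_apply]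
  rw [h1, h2, h3]
  rfl

theorem exists_mul_mul_self_eq (x : Module.End F V) : ∃ y, x * y * x = x := by
  obtain ⟨σ, hσ⟩ := x.rangeRestrict.exists_rightInverse_of_surjective x.range_rangeRestrict
  obtain ⟨p, hp⟩ := LinearMap.exists_extend σ
  refine ⟨p, LinearMap.ext fun v => ?_⟩
  have h1 := LinearMap.congr_fun hp (x.rangeRestrict v)
  have h2 := congrArg Subtype.val (LinearMap.congr_fun hσ (x.rangeRestrict v))
  change p (x v) = σ (x.rangeRestrict v) at h1
  change x (p (x v)) = x v
  rw [h1]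
  exact h2

theorem rankIdeal_le_span_smulRight :
    (rankIdeal F (V := V) ℵ₀ le_rfl).toSubmodule ≤
      Submodule.span F {χ | ∃ (f : Module.Dual F V) (x : V), f.smulRight x = χ} := by
  intro φ hφ
  have : Module.Finite F φ.range := Module.rank_lt_aleph0_iff.mp hφ
  let b := Module.finBasis F φ.range
  have e : φ = ∑ i, (b.coord i ∘ₗ φ.rangeRestrict).smulRight (b i : V) := by
    ext v
    have := congrArg Subtype.val (b.sum_repr (φ.rangeRestrict v))
    simp only [Submodule.coe_sum, Submodule.coe_smul] at this
    simpa using this.symm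
  rw [e]
  exact Submodule.sum_mem _ fun i _ => Submodule.subset_span ⟨_, _, rfl⟩

theorem smulRight_mem_rankIdeal (f : Module.Dual F V) (x : V) :
    (f.smulRight x : Module.End F V) ∈ rankIdeal F ℵ₀ le_rfl := by
  have : LinearMap.rank (f.smulRight x : Module.End F V) ≤ 1 := by
    refine (Submodule.rank_mono (t := Submodule.span F {x}) ?_).trans
      ((rank_span_le _).trans (by simp))
    rintro _ ⟨v, rfl⟩
    exact Submodule.smul_mem _ _ (Submodule.mem_span_singleton_self x)
  exact this.trans_lt Cardinal.one_lt_aleph0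

/-- A proper nonzero two-sided ideal `W` of `End V` is `I_α`, where `α` is the least rank of a map
outside `W`. This `α` is infinite because `W` contains all maps of rank one. -/
theorem eq_top_or_eq_rankIdeal {W : Submodule F (Module.End F V)}
    (hW : ∀ w ∈ W, ∀ p q : Module.End F V, p * w * q ∈ W) (h0 : W ≠ ⊥) :
    W = ⊤ ∨ ∃ (α : Cardinal) (hα : ℵ₀ ≤ α), α ≤ Module.rank F V ∧
      W = (rankIdeal F α hα).toSubmodule := by
  have hfin : (rankIdeal F (V := V) ℵ₀ le_rfl).toSubmodule ≤ W := by
    refine rankIdeal_le_span_smulRight.trans (Submodule.span_le.mpr ?_)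
    rintro _ ⟨f, x, rfl⟩
    obtain ⟨w, hw, hw0⟩ := Submodule.exists_mem_ne_zero_of_ne_bot h0
    obtain ⟨v, hv⟩ : ∃ v, w v ≠ 0 := by
      by_contra! h
      exact hw0 (LinearMap.ext h)
    obtain ⟨g, hg⟩ := Module.Projective.exists_dual_eq_one F hv
    have e : (f.smulRight x : Module.End F V) = g.smulRight x * w * f.smulRight v := by
      ext u
      simp [hg]
    exact e ▸ hW w hw (g.smulRight x) (f.smulRight v)
  by_cases htop : W = ⊤
  · exact Or.inl htop
  obtain ⟨c, hc⟩ : ∃ c, c ∉ W := by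
    by_contra! h
    exact htop (eq_top_iff.mpr fun x _ => h x)
  have hne : {κ : Cardinal | ∃ b ∉ W, LinearMap.rank b = κ}.Nonempty := ⟨_, c, hc, rfl⟩
  obtain ⟨b, hb, hbα⟩ := csInf_mem hne
  have hα : ℵ₀ ≤ LinearMap.rank b := by
    by_contra! h
    exact hb (hfin h)
  refine Or.inr ⟨LinearMap.rank b, hα, LinearMap.rank_le_range b, ?_⟩
  ext φ
  change φ ∈ W ↔ LinearMap.rank φ < LinearMap.rank b
  constructor
  · intro hφ
    by_contra! h
    obtain ⟨p, q, hpq⟩ := exists_eq_mul_mul_of_rank_le h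
    exact hb (hpq ▸ hW φ hφ p q)
  · intro hφ
    by_contra h
    exact hφ.not_ge (hbα.trans_le (csInf_le' ⟨φ, h, rfl⟩))

end Ideals

/-! ### Transformations that are central modulo `I_α` -/

section Central

variable {F V : Type*} [Field F] [AddCommGroup V] [Module F V]

/-- If `u` maps every vector `w` outside a subspace `Y` of codimension at least two into
`F w + Y`, the scalars involved agree, so `u` is a scalar modulo `Y`. -/
theorem exists_forall_sub_smul_mem {Y : Submodule F V} (u : Module.End F V) (h1 : Y ≠ ⊤)
    (h2 : ∀ w, Y ⊔ Submodule.span F {w} ≠ ⊤) (h : ∀ w ∉ Y, ∃ c : F, u w - c • w ∈ Y) :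
    ∃ c : F, ∀ w, u w - c • w ∈ Y := by
  obtain ⟨w₀, -, hw₀⟩ := SetLike.exists_of_lt h1.lt_top
  obtain ⟨c₀, hc₀⟩ := h w₀ hw₀
  refine ⟨c₀, ?_⟩
  have key : ∀ w ∉ Y ⊔ Submodule.span F {w₀}, u w - c₀ • w ∈ Y := by
    intro w hw
    have hind : ∀ a b : F, a • w + b • w₀ ∈ Y → a = 0 ∧ b = 0 := by
      intro a b hab
      have ha : a = 0 := by
        by_contra ha
        apply hw
        have h3 : a⁻¹ • ((a • w + b • w₀) - b • w₀) ∈ Y ⊔ Submodule.span F {w₀} :=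
          Submodule.smul_mem _ _ (Submodule.sub_mem _ (Submodule.mem_sup_left hab)
            (Submodule.mem_sup_right (Submodule.smul_mem _ _ (Submodule.mem_span_singleton_self _))))
        simpa [smul_smul, ha] using h3
      refine ⟨ha, ?_⟩
      by_contra hb
      apply hw₀
      have := Y.smul_mem b⁻¹ hab
      simpa [ha, smul_smul, hb] using this
    obtain ⟨c, hc⟩ := h w fun hwY => hw (Submodule.mem_sup_left hwY)
    obtain ⟨d, hd⟩ := h (w + w₀) fun hwY => one_ne_zero (hind 1 1 (by simpa using hwY)).1
    have h3 := Y.sub_mem (Y.sub_mem hd hc) hc₀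
    have h4 : (c - d) • w + (c₀ - d) • w₀ ∈ Y := by
      convert h3 using 1
      rw [map_add]
      module
    obtain ⟨h5, h6⟩ := hind _ _ h4
    rwa [sub_eq_zero.mp h6, ← sub_eq_zero.mp h5]
  intro w
  by_cases hw : w ∈ Y ⊔ Submodule.span F {w₀}
  · obtain ⟨w₁, -, hw₁⟩ := SetLike.exists_of_lt (h2 w₀).lt_top
    have h3 := key (w + w₁) fun h' => hw₁ (by simpa using Submodule.sub_mem _ h' hw)
    have h4 := Y.sub_mem h3 (key w₁ hw₁)
    convert h4 using 1
    rw [map_add]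
    module
  · exact key w hw

/-- The predicate says that `(x, y) ↦ x + u y` is injective on `X × X`. -/
theorem exists_maximal_injOn_add_apply (u : Module.End F V) :
    ∃ X : Submodule F V, Maximal
      (fun X : Submodule F V => ∀ x ∈ X, ∀ y ∈ X, x + u y = 0 → x = 0 ∧ y = 0) X := by
  refine zorn_le₀ {X : Submodule F V | ∀ x ∈ X, ∀ y ∈ X, x + u y = 0 → x = 0 ∧ y = 0} ?_
  intro c hc hchain
  rcases c.eq_empty_or_nonempty with rfl | hne
  · refine ⟨⊥, ?_, by simp⟩
    intro x hx y hy _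
    exact ⟨(Submodule.mem_bot F).mp hx, (Submodule.mem_bot F).mp hy⟩
  · refine ⟨sSup c, ?_, fun z hz => le_sSup hz⟩
    intro x hx y hy hxy
    obtain ⟨X₁, hX₁, hx⟩ := (Submodule.mem_sSup_of_directed hne hchain.directedOn).mp hx
    obtain ⟨X₂, hX₂, hy⟩ := (Submodule.mem_sSup_of_directed hne hchain.directedOn).mp hy
    rcases hchain.total hX₁ hX₂ with h | h
    · exact hc hX₂ x (h hx) y hy hxy
    · exact hc hX₁ x hx y (h hy) hxy

/-- The centre of `End V / I_α` consists of scalars. Take a maximal subspace `X` such that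
`X × X → V`, `(x, y) ↦ x + u y`, is injective. A map `r` with `r (x + u y) = y` has
`[u, r] x = -x` on `X`, so `dim X < α`; by maximality `u` preserves all lines modulo `X + u X`. -/
theorem exists_rank_sub_smul_lt {α : Cardinal} (hα : ℵ₀ ≤ α) (hαV : α ≤ Module.rank F V)
    {u : Module.End F V} (hu : ∀ r : Module.End F V, LinearMap.rank (u * r - r * u) < α) :
    ∃ c : F, LinearMap.rank (u - c • (1 : Module.End F V)) < α := by
  obtain ⟨X, hX, hmax⟩ := exists_maximal_injOn_add_apply u
  have hXα : Module.rank F X < α := by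
    let g : X × X →ₗ[F] V := X.subtype.coprod (u ∘ₗ X.subtype)
    have hg : LinearMap.ker g = ⊥ := by
      rw [LinearMap.ker_eq_bot']
      rintro ⟨x, y⟩ hxy
      obtain ⟨h1, h2⟩ := hX x x.2 y y.2 (by simpa [g] using hxy)
      ext <;> simp [h1, h2]
    obtain ⟨k, hk⟩ := g.exists_leftInverse_of_injective hg
    let r : Module.End F V := X.subtype ∘ₗ LinearMap.snd F X X ∘ₗ k
    have hr : ∀ x y : X, r (x + u y) = y := by
      intro x y
      have := congrArg (fun z => (z.2 : V)) (LinearMap.congr_fun hk (x, y))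
      simpa [g, r] using this
    refine lt_of_le_of_lt (Submodule.rank_mono ?_) (hu r)
    intro x hx
    refine ⟨-x, ?_⟩
    have h1 := hr ⟨x, hx⟩ 0
    have h2 := hr 0 ⟨x, hx⟩
    simp only [ZeroMemClass.coe_zero, map_zero, add_zero, zero_add] at h1 h2
    simp [h1, h2]
  have hsup : ∀ A B : Submodule F V, Module.rank F A < α → Module.rank F B < α →
      Module.rank F (A ⊔ B : Submodule F V) < α := fun A B hA hB =>
    (Submodule.rank_add_le_rank_add_rank A B).trans_lt (Cardinal.add_lt_of_lt hα hA hB)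
  have htop : ∀ A : Submodule F V, Module.rank F A < α → A ≠ ⊤ := by
    rintro A hA rfl
    rw [rank_top] at hA
    exact hA.not_ge hαV
  have hY : Module.rank F (X ⊔ X.map u : Submodule F V) < α :=
    hsup _ _ hXα ((rank_map_le u X).trans_lt hXα)
  have hline : ∀ w ∉ X ⊔ X.map u, ∃ c : F, u w - c • w ∈ X ⊔ X.map u := by
    intro w hw
    by_contra! hno
    -- If `u w ∉ F w + Y` with `Y = X + u X`, then `X + F w` contradicts the maximality of `X`.
    have hwX : w ∉ X := fun h => hw (Submodule.mem_sup_left h)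
    refine hwX (hmax (y := X ⊔ Submodule.span F {w}) ?_ le_sup_left
      (Submodule.mem_sup_right (Submodule.mem_span_singleton_self w)))
    intro x' hx' y' hy' hxy
    obtain ⟨x, hx, _, hz, rfl⟩ := Submodule.mem_sup.mp hx'
    obtain ⟨a, rfl⟩ := Submodule.mem_span_singleton.mp hz
    obtain ⟨y, hy, _, hz, rfl⟩ := Submodule.mem_sup.mp hy'
    obtain ⟨b, rfl⟩ := Submodule.mem_span_singleton.mp hz
    have hmem : x + u y ∈ X ⊔ X.map u :=
      Submodule.add_mem _ (Submodule.mem_sup_left hx)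
        (Submodule.mem_sup_right (Submodule.mem_map_of_mem hy))
    have hb : b = 0 := by
      by_contra hb
      apply hno (-(b⁻¹ * a))
      have h := Submodule.smul_mem _ (-b⁻¹) hmem
      have e : x + u y = -(a • w) - b • u w := by
        rw [map_add, map_smul] at hxy
        rw [← sub_eq_zero, ← hxy]
        abel
      convert h using 1
      rw [e, smul_sub, smul_smul, neg_mul, inv_mul_cancel₀ hb]
      module
    have ha : a = 0 := by
      by_contra ha
      apply hw
      have h := Submodule.smul_mem _ (-a⁻¹) hmem
      have e : x + u y = -(a • w) := by
        rw [hb, zero_smul, add_zero] at hxy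
        rw [← sub_eq_zero, ← hxy]
        abel
      rw [e, smul_neg, neg_smul, neg_neg, smul_smul, inv_mul_cancel₀ ha, one_smul] at h
      exact h
    subst ha hb
    simp only [zero_smul, add_zero] at hxy ⊢
    exact hX x hx y hy hxy
  obtain ⟨c, hc⟩ := exists_forall_sub_smul_mem u (htop _ hY)
    (fun _ => htop _ (hsup _ _ hY (((rank_span_le _).trans (by simp)).trans_lt
      (Cardinal.one_lt_aleph0.trans_le hα)))) hline
  refine ⟨c, lt_of_le_of_lt (Submodule.rank_mono ?_) hY⟩
  rintro _ ⟨w, rfl⟩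
  simpa using hc w

end Central

/-! ### Commutators in infinite rank -/

section Commutators

variable {F V : Type*} [Field F] [AddCommGroup V] [Module F V]

/-- Every endomorphism `φ` of an infinite-dimensional space is a commutator. Index a basis by
`ι × ℕ` and let `s` be the shift in the second coordinate; then `φ = [a, s]`, where
`a = ∑ k, s ^ k * φ * t ^ (k + 1)` for the left inverse `t` of `s` that vanishes on the vectors
`b (i, 0)`. The range of `a` is contained in `∑ k, s ^ k (range φ)`. -/
theorem exists_commutator_eq (hV : ¬ FiniteDimensional F V) (φ : Module.End F V) :
    ∃ a s : Module.End F V, a * s - s * a = φ ∧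
      LinearMap.rank a ≤ ℵ₀ * LinearMap.rank φ := by
  let b₀ := Module.Basis.ofVectorSpace F V
  set ι := Module.Basis.ofVectorSpaceIndex F V
  have : Infinite ι := by
    by_contra h
    rw [not_infinite_iff_finite] at h
    exact hV (Module.Finite.of_basis b₀)
  obtain ⟨e⟩ : Nonempty (ι ≃ ι × ℕ) := by
    rw [← Cardinal.eq]
    simp
  let b := b₀.reindex e
  let s : Module.End F V := b.constr F fun p => b (p.1, p.2 + 1)
  -- By recursion on the second index: `a (b (i, n + 1)) = φ (b (i, n)) + s (a (b (i, n)))`.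
  let a : Module.End F V := b.constr F fun p =>
    Nat.rec 0 (fun n z => φ (b (p.1, n)) + s z) p.2
  have hs : ∀ i n, s (b (i, n)) = b (i, n + 1) := fun i n => by simp [s]
  have ha : ∀ i n, a (b (i, n + 1)) = φ (b (i, n)) + s (a (b (i, n))) := fun i n => by
    simp [a]
  have ha0 : ∀ i, a (b (i, 0)) = 0 := fun i => by simp [a]
  refine ⟨a, s, ?_, ?_⟩
  · refine b.ext fun ⟨i, n⟩ => ?_
    simp [hs, ha]
  · let L : (ℕ →₀ φ.range) →ₗ[F] V :=
      Finsupp.lsum F fun k => (s ^ k) ∘ₗ φ.range.subtype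
    have hL : ∀ k v, (s ^ k) (φ v) ∈ L.range := fun k v =>
      ⟨Finsupp.single k ⟨φ v, v, rfl⟩, by simp [L]⟩
    have hsL : ∀ x ∈ L.range, s x ∈ L.range := by
      rintro _ ⟨f, rfl⟩
      induction f using Finsupp.induction_linear with
      | zero => simp
      | add f g hf hg => simpa using Submodule.add_mem _ hf hg
      | single k y =>
        obtain ⟨_, v, rfl⟩ := y
        have := hL (k + 1) v
        rw [pow_succ'] at this
        simpa [L] using this
    have haL : a.range ≤ L.range := by
      rw [LinearMap.range_eq_map, ← b.span_eq, Submodule.map_span, Submodule.span_le]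
      rintro _ ⟨_, ⟨⟨i, n⟩, rfl⟩, rfl⟩
      induction n with
      | zero => simp [ha0]
      | succ n ih =>
        rw [ha]
        exact Submodule.add_mem _ (by simpa using hL 0 (b (i, n))) (hsL _ ih)
    refine (Submodule.rank_mono haL).trans ((LinearMap.rank_le_domain L).trans ?_)
    rw [rank_finsupp]
    simp [LinearMap.rank]

/-! ### The trace on transformations of finite rank -/

/-- For `g y = 1`, the commutator `[f ⊗ y, g ⊗ x]` equals `f x • g ⊗ y - f ⊗ x`. -/
theorem smulRight_sub_smul_mem_finiteRankCommutators {g : Module.Dual F V} {y : V} (hg : g y = 1)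
    (f : Module.Dual F V) (x : V) :
    (f.smulRight x - f x • g.smulRight y : Module.End F V) ∈ finiteRankCommutators F V := by
  have h : ⁅(f.smulRight y : Module.End F V), (g.smulRight x : Module.End F V)⁆ ∈
      finiteRankCommutators F V := Submodule.subset_span ⟨_, smulRight_mem_rankIdeal f y, _, rfl⟩
  have h' := Submodule.neg_mem _ h
  convert h' using 1
  ext v
  simp [Ring.lie_def, hg, smul_smul, mul_comm]

/-- The transformations whose matrix in the basis `b` has finitely many nonzero diagonal entries,
with sum zero. On finite-rank transformations the diagonal sum is the trace; `LinearMap.trace` is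
of no use, since it is zero in infinite dimension. -/
def diagonalSumZero {ι : Type*} (b : Module.Basis ι F V) : Submodule F (Module.End F V) where
  carrier := {χ | (Function.support fun i => b.repr (χ (b i)) i).Finite ∧
    ∑ᶠ i, b.repr (χ (b i)) i = 0}
  add_mem' {χ ψ} hχ hψ := by
    simp only [Set.mem_ofPred_eq, LinearMap.add_apply, map_add, Finsupp.add_apply]
    refine ⟨(hχ.1.union hψ.1).subset (Function.support_add _ _), ?_⟩
    rw [finsum_add_distrib hχ.1 hψ.1, hχ.2, hψ.2, add_zero]
  zero_mem' := by simp
  smul_mem' c χ hχ := by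
    simp only [Set.mem_ofPred_eq, LinearMap.smul_apply, map_smul, Finsupp.smul_apply]
    refine ⟨hχ.1.subset (Function.support_const_smul_subset c _), ?_⟩
    rw [← smul_finsum, hχ.2, smul_zero]

theorem finsum_dual_mul_repr {ι : Type*} (b : Module.Basis ι F V) (f : Module.Dual F V) (z : V) :
    ∑ᶠ i, f (b i) * b.repr z i = f z := by
  conv_rhs => rw [← b.linearCombination_repr z, Finsupp.linearCombination_apply, map_finsuppSum]
  rw [finsum_eq_sum_of_support_subset (s := (b.repr z).support), Finsupp.sum]
  · simp [mul_comm]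
  · intro i hi
    simp_all

/-- Both `(f ⊗ x) ψ` and `ψ (f ⊗ x)` have diagonal sum `f (ψ x)`. -/
theorem finiteRankCommutators_le_diagonalSumZero {ι : Type*} (b : Module.Basis ι F V) :
    finiteRankCommutators F V ≤ diagonalSumZero b := by
  refine Submodule.span_le.mpr ?_
  rintro _ ⟨φ, hφ, ψ, rfl⟩
  suffices h : Submodule.span F {χ | ∃ (f : Module.Dual F V) (x : V), f.smulRight x = χ} ≤
      (diagonalSumZero b).comap (LinearMap.mulRight F ψ - LinearMap.mulLeft F ψ) by
    simpa [Ring.lie_def] using h (rankIdeal_le_span_smulRight hφ)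
  refine Submodule.span_le.mpr ?_
  rintro _ ⟨f, x, rfl⟩
  have hfin : ∀ (g : Module.Dual F V) (z : V),
      (Function.support fun i => g (b i) * b.repr z i).Finite := fun g z =>
    (b.repr z).hasFiniteSupport.subset fun i hi => right_ne_zero_of_mul hi
  have e : (fun i => b.repr ((LinearMap.mulRight F ψ - LinearMap.mulLeft F ψ)
      (f.smulRight x : Module.End F V) (b i)) i) =
      fun i => (f ∘ₗ ψ) (b i) * b.repr x i - f (b i) * b.repr (ψ x) i := by
    ext i
    simp
  change (Function.support _).Finite ∧ finsum _ = 0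
  rw [e]
  refine ⟨((hfin _ _).union (hfin _ _)).subset (Function.support_sub _ _), ?_⟩
  rw [finsum_sub_distrib (hfin _ _) (hfin _ _), finsum_dual_mul_repr, finsum_dual_mul_repr]
  simp

/-- A rank-one idempotent has trace one, so it is not a sum of commutators. -/
theorem smulRight_notMem_finiteRankCommutators {g : Module.Dual F V} {y : V} (hg : g y = 1) :
    (g.smulRight y : Module.End F V) ∉ finiteRankCommutators F V := by
  intro h
  have := (finiteRankCommutators_le_diagonalSumZero (Module.Basis.ofVectorSpace F V) h).2
  simp only [LinearMap.smulRight_apply, map_smul, Finsupp.smul_apply, smul_eq_mul,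
    finsum_dual_mul_repr, hg, one_ne_zero] at this

theorem finiteRankCommutators_le_rankIdeal :
    finiteRankCommutators F V ≤ (rankIdeal F (V := V) ℵ₀ le_rfl).toSubmodule := by
  refine Submodule.span_le.mpr ?_
  rintro _ ⟨φ, hφ, ψ, rfl⟩
  exact lie_mem_left F _ _ φ ψ hφ

theorem smul_one_mem_scalarMaps (c : F) : c • (1 : Module.End F V) ∈ scalarMaps F V :=
  Submodule.smul_mem _ _ (Submodule.mem_span_singleton_self _)

theorem mem_scalarAddRank {α : Cardinal} {hα : ℵ₀ ≤ α} {u : Module.End F V} :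
    u ∈ scalarAddRank F V α hα ↔
      ∃ c : F, LinearMap.rank (u - c • (1 : Module.End F V)) < α := by
  constructor
  · intro hu
    obtain ⟨_, hs, w, hw, rfl⟩ := Submodule.mem_sup.mp hu
    obtain ⟨c, rfl⟩ := Submodule.mem_span_singleton.mp hs
    refine ⟨c, ?_⟩
    rw [← Module.End.one_eq_id, add_sub_cancel_left]
    exact hw
  · rintro ⟨c, hc⟩
    rw [← add_sub_cancel (c • (1 : Module.End F V)) u]
    exact Submodule.add_mem_sup (smul_one_mem_scalarMaps c) hc

theorem eq_zero_of_rank_smul_one_lt {α : Cardinal} (hα : α ≤ Module.rank F V) {c : F}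
    (h : LinearMap.rank (c • (1 : Module.End F V)) < α) : c = 0 := by
  by_contra hc
  refine h.not_ge (hα.trans ?_)
  rw [LinearMap.rank, LinearMap.range_smul _ _ hc, Module.End.one_eq_id, LinearMap.range_id,
    rank_top]

/-- The identity and a rank-one idempotent form a basis of the quotient: the first is not of finite
rank, and the second does not have trace zero. -/
theorem rank_quotient_finiteRankCommutators (hV : ¬ FiniteDimensional F V) :
    Module.rank F (↥(scalarAddRank F V ℵ₀ le_rfl) ⧸
      (finiteRankCommutators F V).submoduleOf (scalarAddRank F V ℵ₀ le_rfl)) = 2 := by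
  have hV' : ℵ₀ ≤ Module.rank F V := by
    by_contra! h
    exact hV (Module.rank_lt_aleph0_iff.mp h)
  have : Nontrivial V := by
    by_contra h
    rw [not_nontrivial_iff_subsingleton] at h
    exact hV inferInstance
  obtain ⟨y, hy⟩ := exists_ne (0 : V)
  obtain ⟨g, hg⟩ := Module.Projective.exists_dual_eq_one F hy
  set S := scalarAddRank F V ℵ₀ le_rfl
  let e : S := ⟨g.smulRight y, Submodule.mem_sup_right (smulRight_mem_rankIdeal g y)⟩
  let o : S := ⟨1, Submodule.mem_sup_left (by simpa using smul_one_mem_scalarMaps (V := V) (1 : F))⟩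
  let L : F × F →ₗ[F] S ⧸ (finiteRankCommutators F V).submoduleOf S :=
    Submodule.mkQ _ ∘ₗ (LinearMap.toSpanSingleton F S o).coprod (LinearMap.toSpanSingleton F S e)
  have hspan : (rankIdeal F (V := V) ℵ₀ le_rfl).toSubmodule ≤
      finiteRankCommutators F V ⊔ Submodule.span F {(g.smulRight y : Module.End F V)} := by
    refine rankIdeal_le_span_smulRight.trans (Submodule.span_le.mpr ?_)
    rintro _ ⟨f, x, rfl⟩
    rw [← sub_add_cancel (f.smulRight x : Module.End F V) (f x • g.smulRight y)]
    exact Submodule.add_mem_sup (smulRight_sub_smul_mem_finiteRankCommutators hg f x)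
      (Submodule.smul_mem _ _ (Submodule.mem_span_singleton_self _))
  have hL : Function.Bijective L := by
    constructor
    · rw [← LinearMap.ker_eq_bot, LinearMap.ker_eq_bot']
      rintro ⟨c, d⟩ hcd
      have h : c • (1 : Module.End F V) + d • (g.smulRight y : Module.End F V) ∈
          finiteRankCommutators F V := (Submodule.Quotient.mk_eq_zero _ (x := c • o + d • e)).mp hcd
      have hc : c = 0 := by
        refine eq_zero_of_rank_smul_one_lt hV' ?_
        have h1 := Submodule.sub_mem _ (finiteRankCommutators_le_rankIdeal h)
          (Submodule.smul_mem _ d (smulRight_mem_rankIdeal g y))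
        rw [add_sub_cancel_right] at h1
        exact h1
      have hd : d = 0 := by
        by_contra hd
        rw [hc, zero_smul, zero_add, Submodule.smul_mem_iff _ hd] at h
        exact smulRight_notMem_finiteRankCommutators hg h
      rw [hc, hd]
      rfl
    · intro q
      obtain ⟨⟨u, hu⟩, rfl⟩ := Submodule.mkQ_surjective _ q
      obtain ⟨c, hc⟩ := mem_scalarAddRank.mp hu
      obtain ⟨w, hw, _, hz, hwz⟩ := Submodule.mem_sup.mp (hspan hc)
      obtain ⟨d, rfl⟩ := Submodule.mem_span_singleton.mp hz
      refine ⟨(c, d), ((Submodule.Quotient.eq _).mpr ?_).symm⟩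
      change u - (c • (1 : Module.End F V) + d • (g.smulRight y : Module.End F V)) ∈
        finiteRankCommutators F V
      rwa [← sub_sub, ← hwz, add_sub_cancel_right]
  have h := (LinearEquiv.ofBijective L hL).lift_rank_eq
  rw [rank_prod', Module.rank_self, one_add_one_eq_two] at h
  simpa using h.symm

end Commutators

/-! ### Classification of the Lie ideals -/

section Classification

variable {F V : Type*} [Field F] [AddCommGroup V] [Module F V]

theorem exists_lieIdeal_toSubmodule_eq_iff {U : Submodule F (Module.End F V)} :
    (∃ J : LieIdeal F (Module.End F V), J.toSubmodule = U) ↔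
      ∀ u ∈ U, ∀ r : Module.End F V, u * r - r * u ∈ U := by
  constructor
  · rintro ⟨J, rfl⟩ u hu r
    exact lie_mem_left F _ J u r hu
  · intro h
    refine ⟨{ U with lie_mem := fun {r u} hu => ?_ }, rfl⟩
    have := U.neg_mem (h u hu r)
    rwa [neg_sub] at this

theorem commutator_mem_of_mem_scalarMaps_sup {U W : Submodule F (Module.End F V)}
    (hW : ∀ w ∈ W, ∀ r : Module.End F V, w * r - r * w ∈ U) {u : Module.End F V}
    (hu : u ∈ scalarMaps F V ⊔ W) (r : Module.End F V) : u * r - r * u ∈ U := by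
  obtain ⟨_, hs, w, hw, rfl⟩ := Submodule.mem_sup.mp hu
  obtain ⟨c, rfl⟩ := Submodule.mem_span_singleton.mp hs
  have e : (c • LinearMap.id + w) * r - r * (c • LinearMap.id + w) = w * r - r * w := by
    rw [← Module.End.one_eq_id]
    simp [add_mul, mul_add]
  exact e ▸ hW w hw r

/-- A subspace between `W` and `F · Id + W` is one of the two. -/
theorem eq_or_eq_scalarMaps_sup {U W : Submodule F (Module.End F V)} (h1 : W ≤ U)
    (h2 : U ≤ scalarMaps F V ⊔ W) : U = W ∨ U = scalarMaps F V ⊔ W := by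
  by_cases h : U ≤ W
  · exact Or.inl (le_antisymm h h1)
  · refine Or.inr (le_antisymm h2 (sup_le ?_ h1))
    obtain ⟨u, hu, huW⟩ := SetLike.not_le_iff_exists.mp h
    obtain ⟨_, hs, w, hw, rfl⟩ := Submodule.mem_sup.mp (h2 hu)
    obtain ⟨c, rfl⟩ := Submodule.mem_span_singleton.mp hs
    have hc : c ≠ 0 := by
      rintro rfl
      exact huW (by simpa using hw)
    have h3 := U.sub_mem hu (h1 hw)
    rw [add_sub_cancel_right, Submodule.smul_mem_iff _ hc] at h3
    exact Submodule.span_le.mpr (Set.singleton_subset_iff.mpr h3)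

/-- The ideal `W` is the largest two-sided ideal in the transporter of `End V` into `U`: it
satisfies `[W, End V] ⊆ U` and `[U, End V] ⊆ W`, and `U` is then located by the value of `W`. -/
theorem eq_of_commutator_mem (hF : ringChar F ≠ 2) (hV : ¬ FiniteDimensional F V)
    {U : Submodule F (Module.End F V)} (hU : ∀ u ∈ U, ∀ r : Module.End F V, u * r - r * u ∈ U) :
    (U = ⊥ ∨ U = scalarMaps F V ∨ U = ⊤) ∨
      (∃ (α : Cardinal) (hα : ℵ₀ ≤ α), α ≤ Module.rank F V ∧
        (U = (rankIdeal F α hα).toSubmodule ∨ U = scalarAddRank F V α hα)) ∨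
      (finiteRankCommutators F V ≤ U ∧ U ≤ scalarAddRank F V ℵ₀ le_rfl) := by
  have hUW : ∀ u ∈ U, ∀ r : Module.End F V, u * r - r * u ∈ transporterCore U := fun u hu r =>
    commutator_mem_of_sq_commutator_mem (Ring.two_ne_zero hF) exists_mul_mul_self_eq
      (fun w hw p q => mul_mem_transporterCore hw p q)
      (fun s => commutator_mem_transporterCore hU hu (hU u hu s)) r
  have hWU : ∀ w ∈ transporterCore U, ∀ r : Module.End F V, w * r - r * w ∈ U := fun w hw r =>
    commutator_mem_of_mem_transporterCore hw r
  by_cases h0 : transporterCore U = ⊥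
  · left
    have hle : U ≤ scalarMaps F V ⊔ ⊥ := by
      intro u hu
      have hc : u ∈ Subalgebra.center F (Module.End F V) := by
        rw [Subalgebra.mem_center_iff]
        intro r
        have := hUW u hu r
        rw [h0, Submodule.mem_bot, sub_eq_zero] at this
        exact this.symm
      obtain ⟨c, rfl⟩ := (Algebra.IsCentral.mem_center_iff F).mp hc
      refine Submodule.mem_sup_left ?_
      rw [Algebra.algebraMap_eq_smul_one]
      exact smul_one_mem_scalarMaps c
    rcases eq_or_eq_scalarMaps_sup bot_le hle with h | h
    · exact Or.inl h
    · exact Or.inr (Or.inl (by rwa [sup_bot_eq] at h))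
  -- Every map is a commutator `[a, s]`, where `rank a` is at most `ℵ₀ * rank φ`. Hence `U = ⊤` if
  -- `W = ⊤`, and `I_α ⊆ U` if `W = I_α` with `α` uncountable; for `α = ℵ₀` the bound on `rank a` is
  -- too weak, and only `[I_ℵ₀, End V] ⊆ U` remains.
  rcases eq_top_or_eq_rankIdeal (fun w hw p q => mul_mem_transporterCore hw p q) h0 with
    h | ⟨α, hα, hαV, h⟩
  · refine Or.inl (Or.inr (Or.inr (eq_top_iff.mpr fun φ _ => ?_)))
    obtain ⟨a, s, rfl, -⟩ := exists_commutator_eq hV φ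
    exact hWU a (h ▸ Submodule.mem_top) s
  · right
    rw [h] at hUW hWU
    have hle : U ≤ scalarAddRank F V α hα := fun u hu =>
      mem_scalarAddRank.mpr (exists_rank_sub_smul_lt hα hαV (hUW u hu))
    rcases hα.eq_or_lt with rfl | hlt
    · refine Or.inr ⟨Submodule.span_le.mpr ?_, hle⟩
      rintro _ ⟨φ, hφ, ψ, rfl⟩
      exact hWU φ hφ ψ
    · refine Or.inl ⟨α, hα, hαV, eq_or_eq_scalarMaps_sup (fun φ hφ => ?_) hle⟩
      obtain ⟨a, s, rfl, ha⟩ := exists_commutator_eq hV φ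
      exact hWU a (ha.trans_lt (Cardinal.mul_lt_of_lt hα hlt hφ)) s

end Classification

theorem theorem1 {F V : Type*} [Field F] [AddCommGroup V] [Module F V]
    (hF : ringChar F ≠ 2) (hV : ¬ FiniteDimensional F V) :
    (∀ U : Submodule F (Module.End F V),
      (∃ J : LieIdeal F (Module.End F V), J.toSubmodule = U) ↔
        ((U = ⊥ ∨ U = scalarMaps F V ∨ U = ⊤) ∨
          (∃ (α : Cardinal) (hα : ℵ₀ ≤ α), α ≤ Module.rank F V ∧
            (U = (rankIdeal F α hα).toSubmodule ∨ U = scalarAddRank F V α hα)) ∨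
          (finiteRankCommutators F V ≤ U ∧ U ≤ scalarAddRank F V ℵ₀ le_rfl))) ∧
    finiteRankCommutators F V ≤ scalarAddRank F V ℵ₀ le_rfl ∧
    Module.rank F (↥(scalarAddRank F V ℵ₀ le_rfl) ⧸
      (finiteRankCommutators F V).submoduleOf (scalarAddRank F V ℵ₀ le_rfl)) = 2 := by
  refine ⟨fun U => ?_, finiteRankCommutators_le_rankIdeal.trans le_sup_right,
    rank_quotient_finiteRankCommutators hV⟩
  rw [exists_lieIdeal_toSubmodule_eq_iff]
  refine ⟨eq_of_commutator_mem hF hV, ?_⟩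
  have hrank : ∀ (α : Cardinal) (hα : ℵ₀ ≤ α), ∀ w ∈ (rankIdeal F (V := V) α hα).toSubmodule,
      ∀ r : Module.End F V, w * r - r * w ∈ (rankIdeal F α hα).toSubmodule := fun α hα =>
    exists_lieIdeal_toSubmodule_eq_iff.mp ⟨_, rfl⟩
  have hsup : ∀ W : Submodule F (Module.End F V),
      (∀ w ∈ W, ∀ r : Module.End F V, w * r - r * w ∈ W) →
      ∀ u ∈ scalarMaps F V ⊔ W, ∀ r : Module.End F V, u * r - r * u ∈ scalarMaps F V ⊔ W :=
    fun W hW u hu r => Submodule.mem_sup_right (commutator_mem_of_mem_scalarMaps_sup hW hu r)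
  rintro ((rfl | rfl | rfl) | ⟨α, hα, -, rfl | rfl⟩ | ⟨h1, h2⟩)
  · simp
  · simpa only [sup_bot_eq] using hsup ⊥ (by simp)
  · simp
  · exact hrank α hα
  · exact hsup _ (hrank α hα)
  · exact fun u hu => commutator_mem_of_mem_scalarMaps_sup
      (fun w hw r => h1 (Submodule.subset_span ⟨w, hw, r, rfl⟩)) (h2 hu)
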